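/- An affine plane consists of points and lines such that two distinct points lie on exactly one line; through a point $P$ not on a line $\ell$ there is exactly one line that does not meet $\ell$; and there are three distinct non-collinear points. Lines are parallel if they are equal or disjoint. It is a Desargues affine plane if, whenever the vertices of triangles $ABC$, $A'B'C'$ satisfy $A,A'\in a$, $B,B'\in b$, $C,C'\in c$ for three distinct lines $a,b,c$ that are parallel or pass through a common point different from the vertices, $AB\parallel A'B'$ and $BC\parallel B'C'$ imply $AC\parallel A'C'$. It is a Pappus affine plane if, for any two distinct lines $\ell,m$, points $A,B,C\in\ell\setminus m$ and $A',B',C'\in m\setminus\ell$, $AB'\parallel A'B$ and $BC'\parallel B'C$ imply $AC'\parallel A'C$. Fix distinct points $O,I$ of an affine plane and let $\ell^{OI}$ be the line through them. For $A,B\in\ell^{OI}$ choose an auxiliary point $E\notin\ell^{OI}$. The sum $A+B$ is the point where $\ell^{OI}$ meets the parallel to $BE$ through $P_1$, where $P_1$ is the intersection of the parallel to $\ell^{OI}$ through $E$ with the parallel to $OE$ through $A$. The product $A\cdot B$ is the point where $\ell^{OI}$ meets the parallel to $BE$ through $P_1$, where now $P_1$ is the intersection of the parallel to $IE$ through $A$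 with the line $OE$. The auxiliary point may be chosen separately for each sum and each product; the statements below hold for every such choice. Let $-A$ be the point with $A+(-A)=(-A)+A=O$, and for $A\ne O$ let $A^{-1}$ be the point with $A\cdot A^{-1}=A^{-1}\cdot A=I$; write $A-B=A+(-B)$. The ratio of $A,B,C\in\ell^{OI}$ with $B\neq C$ is $r(A,B;C)=(B-C)^{-1}\cdot(A-C)$. (1) In a Desargues affine plane, for any three distinct points $A,B,C\in\ell^{OI}$ different from $O$, $$r(A^{-1},B^{-1};C^{-1})=\bigl(B\cdot r(A,B;C)\bigr)\cdot A^{-1}.$$ (2) In a Pappus affine plane, for any points $A,B,C\in\ell^{OI}$ different from $O$ with $B\neq C$, $$r(A^{-1},B^{-1};C^{-1})=r(A,B;C)\cdot r(B,A;O).$$ -/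

import Mathlib

universe u v

/-- An affine plane: `P` is the set of points, `L` the set of lines and `∈` the incidence. -/
class AffinePlane (P : Type u) (L : Type v) [Membership P L] : Prop where
  /-- Two distinct points lie on exactly one line. -/
  existsUnique_line : ∀ X Y : P, X ≠ Y → ∃! l : L, X ∈ l ∧ Y ∈ l
  /-- Through a point outside a line there is exactly one line missing the given one. -/
  existsUnique_disjoint : ∀ (X : P) (l : L), X ∉ l → ∃! m : L, X ∈ m ∧ ∀ Y : P, Y ∈ l → Y ∉ m
  /-- There are three distinct points that do not lie on one line. -/
  exists_triangle : ∃ X Y Z : P, X ≠ Y ∧ Y ≠ Z ∧ X ≠ Z ∧ ∀ l : L, ¬ (X ∈ l ∧ Y ∈ l ∧ Z ∈ l)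

namespace AffinePlane

section Basic

variable {P : Type u} {L : Type v} [Membership P L]

/-- Two lines are parallel if they are equal or have no common point. -/
def Parallel (l m : L) : Prop := l = m ∨ ∀ X : P, X ∈ l → X ∉ m

variable (P L) in
/-- Desargues' axiom. The triangles `ABC` and `A'B'C'` have their corresponding vertices on three
distinct lines `a`, `b`, `c`, which are parallel, or pass through a common point `S` other than the
vertices; `ab`, `bc`, `ac`, `ab'`, `bc'`, `ac'` are the sides. If two pairs of corresponding sides
are parallel, then so is the third. -/
def IsDesargues : Prop :=
  ∀ (A B C A' B' C' : P) (a b c ab bc ac ab' bc' ac' : L),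
    a ≠ b → b ≠ c → a ≠ c →
    A ∈ a → A' ∈ a → B ∈ b → B' ∈ b → C ∈ c → C' ∈ c →
    ((Parallel (P := P) a b ∧ Parallel (P := P) b c) ∨
      ∃ S : P, S ∈ a ∧ S ∈ b ∧ S ∈ c ∧
        A ≠ S ∧ B ≠ S ∧ C ≠ S ∧ A' ≠ S ∧ B' ≠ S ∧ C' ≠ S) →
    A ∈ ab → B ∈ ab → B ∈ bc → C ∈ bc → A ∈ ac → C ∈ ac →
    A' ∈ ab' → B' ∈ ab' → B' ∈ bc' → C' ∈ bc' → A' ∈ ac' → C' ∈ ac' →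
    Parallel (P := P) ab ab' → Parallel (P := P) bc bc' → Parallel (P := P) ac ac'

variable (P L) in
/-- Pappus' axiom. The points `A`, `B`, `C` lie on `l` but not on `m`, the points `A'`, `B'`, `C'`
lie on `m` but not on `l`; `ab'` is the line `AB'`, and so on. If `AB' ∥ A'B` and `BC' ∥ B'C`,
then `AC' ∥ A'C`. -/
def IsPappus : Prop :=
  ∀ (A B C A' B' C' : P) (l m ab' a'b bc' b'c ac' a'c : L),
    A ∈ l → B ∈ l → C ∈ l → A ∉ m → B ∉ m → C ∉ m →
    A' ∈ m → B' ∈ m → C' ∈ m → A' ∉ l → B' ∉ l → C' ∉ l →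
    A ∈ ab' → B' ∈ ab' → A' ∈ a'b → B ∈ a'b →
    B ∈ bc' → C' ∈ bc' → B' ∈ b'c → C ∈ b'c →
    A ∈ ac' → C' ∈ ac' → A' ∈ a'c → C ∈ a'c →
    Parallel (P := P) ab' a'b → Parallel (P := P) bc' b'c → Parallel (P := P) ac' a'c

theorem Parallel.symm {l m : L} (h : Parallel (P := P) l m) : Parallel (P := P) m l := by
  rcases h with h | h
  · exact Or.inl h.symm
  · exact Or.inr fun X hm hl => h X hl hm

theorem Parallel.eq {l m : L} (h : Parallel (P := P) l m) {X : P} (hl : X ∈ l) (hm : X ∈ m) :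
    l = m := by
  rcases h with h | h
  · exact h
  · exact absurd hm (h X hl)

theorem not_parallel_of_mem {l m : L} {X Y : P} (hXl : X ∈ l) (hXm : X ∈ m) (hYl : Y ∈ l)
    (hYm : Y ∉ m) : ¬ Parallel (P := P) l m :=
  fun h => hYm (h.eq hXl hXm ▸ hYl)

variable [AffinePlane P L]

theorem eq_of_mem {X Y : P} (h : X ≠ Y) {l m : L} (hXl : X ∈ l) (hYl : Y ∈ l) (hXm : X ∈ m)
    (hYm : Y ∈ m) : l = m :=
  (existsUnique_line X Y h).unique ⟨hXl, hYl⟩ ⟨hXm, hYm⟩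

theorem Parallel.trans {l m n : L} (h : Parallel (P := P) l m) (h' : Parallel (P := P) m n) :
    Parallel (P := P) l n := by
  by_cases hln : ∃ X : P, X ∈ l ∧ X ∈ n
  · obtain ⟨X, hl, hn⟩ := hln
    by_cases hm : X ∈ m
    · rw [h.eq hl hm]; exact h'
    · refine Or.inl ((existsUnique_disjoint X m hm).unique ⟨hl, ?_⟩ ⟨hn, ?_⟩)
      · intro Y hYm hYl
        exact hm (h.eq hYl hYm ▸ hl)
      · intro Y hYm hYn
        exact hm (h'.eq hYm hYn ▸ hn)
  · exact Or.inr fun X hl hn => hln ⟨X, hl, hn⟩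

theorem existsUnique_parallel (l : L) (X : P) : ∃! m : L, X ∈ m ∧ Parallel (P := P) l m := by
  by_cases h : X ∈ l
  · exact ⟨l, ⟨h, Or.inl rfl⟩, fun m hm => (hm.2.eq h hm.1).symm⟩
  · obtain ⟨m, hm, hu⟩ := existsUnique_disjoint X l h
    refine ⟨m, ⟨hm.1, Or.inr hm.2⟩, fun n hn => hu n ⟨hn.1, fun Y hl hn' => ?_⟩⟩
    exact h (hn.2.eq hl hn' ▸ hn.1)

theorem existsUnique_meet {l m : L} (h : ¬ Parallel (P := P) l m) :
    ∃! X : P, X ∈ l ∧ X ∈ m := by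
  have hne : l ≠ m := fun e => h (Or.inl e)
  have hex : ∃ X : P, X ∈ l ∧ X ∈ m := by
    by_contra hno
    exact h (Or.inr fun X hl hm => hno ⟨X, hl, hm⟩)
  obtain ⟨X, hX⟩ := hex
  refine ⟨X, hX, fun Y hY => ?_⟩
  by_contra hYX
  exact hne (eq_of_mem hYX hY.1 hX.1 hY.2 hX.2)

theorem exists_notMem (l : L) : ∃ X : P, X ∉ l := by
  obtain ⟨X, Y, Z, -, -, -, h⟩ := exists_triangle (P := P) (L := L)
  by_contra hno
  push Not at hno
  exact h l ⟨hno X, hno Y, hno Z⟩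

/-- The line through two distinct points. -/
noncomputable def join {X Y : P} (h : X ≠ Y) : L := (existsUnique_line X Y h).choose

theorem left_mem_join {X Y : P} (h : X ≠ Y) : X ∈ (join h : L) :=
  (existsUnique_line (L := L) X Y h).choose_spec.1.1

theorem right_mem_join {X Y : P} (h : X ≠ Y) : Y ∈ (join h : L) :=
  (existsUnique_line (L := L) X Y h).choose_spec.1.2

/-- The line through the point `X` parallel to the line `l`. -/
noncomputable def par (l : L) (X : P) : L := (existsUnique_parallel l X).choose

theorem mem_par (l : L) (X : P) : X ∈ par l X := (existsUnique_parallel l X).choose_spec.1.1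

theorem parallel_par (l : L) (X : P) : Parallel (P := P) l (par l X) :=
  (existsUnique_parallel l X).choose_spec.1.2

/-- The common point of two lines that are not parallel. -/
noncomputable def meet {l m : L} (h : ¬ Parallel (P := P) l m) : P := (existsUnique_meet h).choose

theorem meet_mem_left {l m : L} (h : ¬ Parallel (P := P) l m) : meet h ∈ l :=
  (existsUnique_meet h).choose_spec.1.1

theorem meet_mem_right {l m : L} (h : ¬ Parallel (P := P) l m) : meet h ∈ m :=
  (existsUnique_meet h).choose_spec.1.2

end Basic

/-- Two distinct points `O`, `I` of a plane, with the line on which they lie. -/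
structure Frame (P : Type u) (L : Type v) [Membership P L] where
  O : P
  I : P
  line : L
  ne : O ≠ I
  O_mem : O ∈ line
  I_mem : I ∈ line

namespace Frame

variable {P : Type u} {L : Type v} [Membership P L]

/-- The points of the line `OI`. -/
abbrev Pt (F : Frame P L) : Type u := {X : P // X ∈ F.line}

/-- The points outside the line `OI`. -/
abbrev Off (F : Frame P L) : Type u := {X : P // X ∉ F.line}

/-- `O` as a point of the line `OI`. -/
def zero (F : Frame P L) : F.Pt := ⟨F.O, F.O_mem⟩

/-- `I` as a point of the line `OI`. -/
def one (F : Frame P L) : F.Pt := ⟨F.I, F.I_mem⟩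

instance (F : Frame P L) : Nonempty F.Pt := ⟨F.zero⟩

theorem ne_off {F : Frame P L} (A : F.Pt) (E : F.Off) : A.1 ≠ E.1 :=
  fun h => E.2 (h ▸ A.2)

variable [AffinePlane P L]

instance (F : Frame P L) : Nonempty F.Off :=
  let ⟨X, hX⟩ := exists_notMem (P := P) F.line
  ⟨⟨X, hX⟩⟩

/-- The line joining a point of `OI` to a point outside `OI`. -/
noncomputable def ray {F : Frame P L} (A : F.Pt) (E : F.Off) : L := join (ne_off A E)

theorem not_parallel_ray {F : Frame P L} (A : F.Pt) (E : F.Off) :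
    ¬ Parallel (P := P) (ray A E) F.line :=
  not_parallel_of_mem (left_mem_join (ne_off A E)) A.2 (right_mem_join (ne_off A E)) E.2

theorem not_parallel_par_ray {F : Frame P L} (A : F.Pt) (E : F.Off) (X : P) :
    ¬ Parallel (P := P) (par (ray A E) X) F.line :=
  fun h => not_parallel_ray A E ((parallel_par _ X).trans h)

theorem not_parallel_add {F : Frame P L} (A B : F.Pt) (E : F.Off) :
    ¬ Parallel (P := P) (par F.line E.1) (par (ray A E) B.1) :=
  fun h => not_parallel_par_ray A E B.1 (h.symm.trans (parallel_par _ E.1).symm)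

theorem not_parallel_mul {F : Frame P L} (A : F.Pt) (E : F.Off) :
    ¬ Parallel (P := P) (par (ray F.one E) A.1) (ray F.zero E) := by
  intro h
  have h1 : (ray F.one E : L) = ray F.zero E :=
    ((parallel_par _ A.1).trans h).eq (right_mem_join (ne_off F.one E))
      (right_mem_join (ne_off F.zero E))
  have hI : F.I ∈ (ray F.zero E : L) := h1 ▸ left_mem_join (ne_off F.one E)
  exact not_parallel_ray F.zero E
    (Or.inl (eq_of_mem F.ne (left_mem_join (ne_off F.zero E)) hI F.O_mem F.I_mem))

/-- The sum `A + B` constructed with the auxiliary point `E` outside `OI`: the parallel to `OI`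
through `E` and the parallel to `OE` through `A` meet in `P₁`; the parallel to `BE` through `P₁`
meets `OI` in `A + B`. -/
noncomputable def sumVia {F : Frame P L} (E : F.Off) (A B : F.Pt) : F.Pt :=
  let P₁ : P := meet (not_parallel_add F.zero A E)
  ⟨meet (not_parallel_par_ray B E P₁), meet_mem_right _⟩

/-- The product `A · B` constructed with the auxiliary point `E` outside `OI`: the parallel to `IE`
through `A` and the line `OE` meet in `P₁`; the parallel to `BE` through `P₁` meets `OI` in
`A · B`. -/
noncomputable def prodVia {F : Frame P L} (E : F.Off) (A B : F.Pt) : F.Pt :=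
  let P₁ : P := meet (not_parallel_mul A E)
  ⟨meet (not_parallel_par_ray B E P₁), meet_mem_right _⟩

end Frame

/-- A choice of an auxiliary point outside `OI` for each sum and for each product. -/
structure Auxiliary {P : Type u} {L : Type v} [Membership P L] (F : Frame P L) where
  forSum : F.Pt → F.Pt → F.Off
  forProd : F.Pt → F.Pt → F.Off

namespace Auxiliary

variable {P : Type u} {L : Type v} [Membership P L] [AffinePlane P L] {F : Frame P L}

instance : Nonempty (Auxiliary F) :=
  let ⟨E⟩ := (inferInstance : Nonempty F.Off)
  ⟨⟨fun _ _ => E, fun _ _ => E⟩⟩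

/-- The sum `A + B` of points of the line `OI`. -/
noncomputable def add (κ : Auxiliary F) (A B : F.Pt) : F.Pt := Frame.sumVia (κ.forSum A B) A B

/-- The product `A · B` of points of the line `OI`. -/
noncomputable def mul (κ : Auxiliary F) (A B : F.Pt) : F.Pt := Frame.prodVia (κ.forProd A B) A B

/-- The opposite `-A`: the point `X` with `A + X = X + A = O`. -/
noncomputable def neg (κ : Auxiliary F) (A : F.Pt) : F.Pt :=
  Classical.epsilon fun X => κ.add A X = F.zero ∧ κ.add X A = F.zero

/-- The inverse `A⁻¹` of `A ≠ O`: the point `X` with `A · X = X · A = I`. -/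
noncomputable def inv (κ : Auxiliary F) (A : F.Pt) : F.Pt :=
  Classical.epsilon fun X => κ.mul A X = F.one ∧ κ.mul X A = F.one

/-- The difference `A - B = A + (-B)`. -/
noncomputable def sub (κ : Auxiliary F) (A B : F.Pt) : F.Pt := κ.add A (κ.neg B)

/-- The ratio `r(A, B; C) = (B - C)⁻¹ · (A - C)` of three points of the line `OI`, `B ≠ C`. -/
noncomputable def ratio (κ : Auxiliary F) (A B C : F.Pt) : F.Pt :=
  κ.mul (κ.inv (κ.sub B C)) (κ.sub A C)

end Auxiliary

end AffinePlane

/-! The sum and the product are values of maps of the plane that preserve directions (dilatations).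
If `f` is the translation taking O to A, the construction of A + B finds P₁ = f(E) and then f(B). If
`f` is the dilatation fixing O and taking I to A, the construction of A · B does the same. So E
drops out (`sumVia_eq`, `prodVia_eq`). The ring laws on OI become statements about composing these
maps; they hold because a translation is determined by one value and a dilatation by two
(`exists_divisionRing`).

The axioms are needed for existence. Desargues for triangles in perspective from a point yields all
homotheties (`exists_homothety`). Two homotheties compose to a translation as soon as lines have
three points, which O, B, C guarantee; the parallel case of Desargues is never needed. In a Pappus
plane the central case is Hessenberg's theorem, and Pappus also makes the product commutative.

What remains is B⁻¹ - C⁻¹ = C⁻¹(C - B)B⁻¹ in a division ring: in the ratio the factor C⁻¹ cancels,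
leaving B · r(A, B; C) · A⁻¹. If the product commutes, B and A⁻¹ combine to A⁻¹B = r(B, A; O). -/

namespace AffinePlane

/-! ### Incidence and the number of points on a line -/

section Incidence

variable {P : Type u} {L : Type v} [Membership P L]

theorem Parallel.refl (l : L) : Parallel (P := P) l l := Or.inl rfl

variable [AffinePlane P L]

theorem point_eq {l m : L} (h : l ≠ m) {X Y : P} (hXl : X ∈ l) (hYl : Y ∈ l) (hXm : X ∈ m)
    (hYm : Y ∈ m) : X = Y := by
  by_contra hXY
  exact h (eq_of_mem hXY hXl hYl hXm hYm)

theorem exists_par (l : L) (X : P) : ∃ m : L, X ∈ m ∧ Parallel (P := P) l m :=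
  ⟨par l X, mem_par l X, parallel_par l X⟩

theorem exists_meet {l m : L} (h : ¬ Parallel (P := P) l m) : ∃ X : P, X ∈ l ∧ X ∈ m :=
  ⟨meet h, meet_mem_left h, meet_mem_right h⟩

theorem exists_join {X Y : P} (h : X ≠ Y) : ∃ l : L, X ∈ l ∧ Y ∈ l :=
  ⟨join h, left_mem_join h, right_mem_join h⟩

theorem exists_point_ne (L : Type v) [Membership P L] [AffinePlane P L] (X : P) :
    ∃ Y : P, Y ≠ X := by
  obtain ⟨U, V, -, hUV, -⟩ := exists_triangle (P := P) (L := L)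
  by_cases h : U = X
  · exact ⟨V, fun e => hUV (h.trans e.symm)⟩
  · exact ⟨U, h⟩

variable (L) in
theorem exists_line (X Y : P) : ∃ l : L, X ∈ l ∧ Y ∈ l := by
  by_cases h : X = Y
  · obtain ⟨Z, hZ⟩ := exists_point_ne L X
    obtain ⟨l, hl⟩ := exists_join (L := L) hZ
    exact ⟨l, hl.2, h ▸ hl.2⟩
  · exact exists_join h

/-- Every line has a point different from a given one. -/
theorem exists_mem_ne {l : L} {S : P} (hS : S ∈ l) : ∃ X : P, X ∈ l ∧ X ≠ S := by
  obtain ⟨Y, hY⟩ := exists_notMem (P := P) l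
  obtain ⟨n, hSn, hYn⟩ := exists_line L S Y
  obtain ⟨Z, hZ⟩ := exists_notMem (P := P) n
  obtain ⟨k, hZk, hnk⟩ := exists_par n Z
  have hkl : ¬ Parallel (P := P) k l := fun h => hY ((hnk.trans h).eq hSn hS ▸ hYn)
  obtain ⟨X, hXk, hXl⟩ := exists_meet hkl
  refine ⟨X, hXl, ?_⟩
  rintro rfl
  exact hZ (hnk.eq hSn hXk ▸ hZk)

/-- Through a point of two lines passes a third line. -/
theorem exists_third_ray {S : P} {l m : L} (hl : S ∈ l) (hm : S ∈ m) (hlm : l ≠ m) :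
    ∃ G : P, G ∉ l ∧ G ∉ m := by
  obtain ⟨X, hXl, hXS⟩ := exists_mem_ne hl
  obtain ⟨Y, hYm, hYS⟩ := exists_mem_ne hm
  have hXm : X ∉ m := fun h => hXS (point_eq hlm hXl hl h hm)
  have hYl : Y ∉ l := fun h => hYS (point_eq hlm h hl hYm hm)
  obtain ⟨n, hXn, hYn⟩ := exists_line L X Y
  obtain ⟨k, hSk, hnk⟩ := exists_par n S
  obtain ⟨G, hGk, hGS⟩ := exists_mem_ne hSk
  refine ⟨G, fun h => ?_, fun h => ?_⟩
  · have : k = l := eq_of_mem hGS hGk hSk h hl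
    subst this
    exact hYl (hnk.eq hXn hXl ▸ hYn)
  · have : k = m := eq_of_mem hGS hGk hSk h hm
    subst this
    exact hXm (hnk.eq hYn hYm ▸ hXn)

/-- Parallel projection from `l` to `m`, along a line joining a point of `l` outside `m` to a point
of `m` outside `l`, is injective, so three points on one line give three on every line. -/
theorem exists_mem_ne_ne_of_line {l : L} {X Y Z : P} (hX : X ∈ l) (hY : Y ∈ l) (hZ : Z ∈ l)
    (hXY : X ≠ Y) (hYZ : Y ≠ Z) (hXZ : X ≠ Z) (m : L) (U V : P) :
    ∃ W : P, W ∈ m ∧ W ≠ U ∧ W ≠ V := by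
  have pick : ∀ X' Y' Z' : P, X' ≠ Y' → Y' ≠ Z' → X' ≠ Z' → X' ∈ m → Y' ∈ m → Z' ∈ m →
      ∃ W : P, W ∈ m ∧ W ≠ U ∧ W ≠ V := by
    intro X' Y' Z' h1 h2 h3 k1 k2 k3
    by_cases hXU : X' = U ∨ X' = V
    · by_cases hYU : Y' = U ∨ Y' = V
      · exact ⟨Z', k3, by grind, by grind⟩
      · exact ⟨Y', k2, by grind, by grind⟩
    · exact ⟨X', k1, by grind, by grind⟩
  by_cases hlm : l = m
  · subst hlm
    exact pick X Y Z hXY hYZ hXZ hX hY hZ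
  obtain ⟨A, hAl, hAm⟩ : ∃ A : P, A ∈ l ∧ A ∉ m := by
    by_cases h : X ∈ m
    · exact ⟨Y, hY, fun h' => hXY (point_eq hlm hX hY h h')⟩
    · exact ⟨X, hX, h⟩
  obtain ⟨B, hBm, hBl⟩ : ∃ B : P, B ∈ m ∧ B ∉ l := by
    obtain ⟨S, T, hSm, hTm, hST⟩ : ∃ S T : P, S ∈ m ∧ T ∈ m ∧ S ≠ T := by
      obtain ⟨n, hAn, hmn⟩ := exists_par m A
      obtain ⟨S, hS⟩ := exists_point_ne L A
      obtain ⟨k, hk⟩ : ∃ k : L, A ∈ k ∧ k ≠ n := by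
        obtain ⟨D, hD⟩ := exists_notMem (P := P) n
        obtain ⟨k, hAk, hDk⟩ := exists_line L A D
        exact ⟨k, hAk, fun e => hD (e ▸ hDk)⟩
      obtain ⟨T, hTm, -⟩ := exists_meet (l := m) (m := k)
        fun h => hk.2 ((h.symm.trans hmn).eq hk.1 hAn)
      obtain ⟨T', h, h'⟩ := exists_mem_ne hTm
      exact ⟨T, T', hTm, h, h'.symm⟩
    by_cases h : S ∈ l
    · exact ⟨T, hTm, fun h' => hST (point_eq hlm h h' hSm hTm)⟩
    · exact ⟨S, hSm, h⟩
  obtain ⟨n, hAn, hBn⟩ := exists_line L A B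
  have hnl : ¬ Parallel (P := P) n l := not_parallel_of_mem hAn hAl hBn hBl
  have hnm : ¬ Parallel (P := P) n m := not_parallel_of_mem hBn hBm hAn hAm
  have proj : ∀ X : P, ∃ X' : P, X' ∈ m ∧ ∃ k : L, X ∈ k ∧ X' ∈ k ∧ Parallel (P := P) n k := by
    intro X
    obtain ⟨k, hXk, hk⟩ := exists_par n X
    obtain ⟨X', hX'k, hX'm⟩ := exists_meet (l := k) (m := m) fun h => hnm (hk.trans h)
    exact ⟨X', hX'm, k, hXk, hX'k, hk⟩
  choose f hfm hf using proj
  have inj : ∀ {X Y : P}, X ∈ l → Y ∈ l → X ≠ Y → f X ≠ f Y := by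
    intro X Y hX hY hXY e
    obtain ⟨k, hXk, hfk, hk⟩ := hf X
    obtain ⟨k', hYk', hfk', hk'⟩ := hf Y
    have : k = k' := (hk.symm.trans hk').eq hfk (e ▸ hfk')
    subst this
    exact hnl (eq_of_mem hXY hXk hYk' hX hY ▸ hk)
  exact pick (f X) (f Y) (f Z) (inj hX hY hXY) (inj hY hZ hYZ) (inj hX hZ hXZ)
    (hfm X) (hfm Y) (hfm Z)

end Incidence

/-! ### Directions and dilatations -/

section SameDir

variable {P : Type u} {L : Type v} [Membership P L]

variable (L) in
/-- The point `Y'` lies on the parallel through `X'` to the line `XY`, and `X' = Y'` if `X = Y`. -/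
def SameDir (X Y X' Y' : P) : Prop :=
  ∀ l m : L, X ∈ l → Y ∈ l → X' ∈ m → Parallel (P := P) l m → Y' ∈ m

theorem SameDir.refl (X X' : P) : SameDir L X X X' X' := fun _ _ _ _ h _ => h

theorem SameDir.mem {X Y X' Y' : P} (h : SameDir L X Y X' Y') {l : L} (hX : X ∈ l) (hY : Y ∈ l)
    (hX' : X' ∈ l) : Y' ∈ l := h l l hX hY hX' (.refl l)

variable (L) in
/-- A map under which the line through the images of two points is parallel to the line through
these points, or the images coincide. -/
def IsDilatation (f : P → P) : Prop := ∀ X Y : P, SameDir L X Y (f X) (f Y)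

theorem IsDilatation.id : IsDilatation L (fun X : P => X) :=
  fun _ _ _ _ hX hY hX' hlm => hlm.eq hX hX' ▸ hY

theorem IsDilatation.const (S : P) : IsDilatation L (fun _ : P => S) :=
  fun _ _ _ _ _ _ h _ => h

variable [AffinePlane P L]

theorem SameDir.of_parallel {X Y X' Y' : P} (h : X ≠ Y) {l m : L} (hX : X ∈ l) (hY : Y ∈ l)
    (hX' : X' ∈ m) (hY' : Y' ∈ m) (hlm : Parallel (P := P) l m) : SameDir L X Y X' Y' := by
  intro l' m' h1 h2 h3 h4
  have e : l = l' := eq_of_mem h hX hY h1 h2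
  subst e
  exact (hlm.symm.trans h4).eq hX' h3 ▸ hY'

theorem SameDir.of_mem {X Y X' Y' : P} (h : X ≠ Y) {l : L} (hX : X ∈ l) (hY : Y ∈ l)
    (hX' : X' ∈ l) (hY' : Y' ∈ l) : SameDir L X Y X' Y' :=
  .of_parallel h hX hY hX' hY' (.refl l)

theorem SameDir.swap {X Y X' Y' : P} (h : SameDir L X Y X' Y') : SameDir L Y X Y' X' := by
  intro l m hY hX hY' hlm
  obtain ⟨n, hn, hln⟩ := exists_par l X'
  exact (hln.symm.trans hlm).eq (h l n hX hY hn hln) hY' ▸ hn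

theorem SameDir.trans {X Y X' Y' X'' Y'' : P} (h : SameDir L X Y X' Y')
    (h' : SameDir L X' Y' X'' Y'') : SameDir L X Y X'' Y'' := by
  intro l m hX hY hX'' hlm
  obtain ⟨n, hn, hln⟩ := exists_par l X'
  exact h' n m hn (h l n hX hY hn hln) hX'' (hln.symm.trans hlm)

/-- The position of a point is determined by two directions. -/
theorem SameDir.unique {X Z Y X' Z' Y₁ Y₂ : P} {l : L} (hXZ : X ≠ Z) (hX : X ∈ l) (hZ : Z ∈ l)
    (hY : Y ∉ l) (h₁ : SameDir L X Y X' Y₁) (k₁ : SameDir L Z Y Z' Y₁)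
    (h₂ : SameDir L X Y X' Y₂) (k₂ : SameDir L Z Y Z' Y₂) : Y₁ = Y₂ := by
  obtain ⟨x, hXx, hYx⟩ := exists_line L X Y
  obtain ⟨z, hZz, hYz⟩ := exists_line L Z Y
  obtain ⟨x', hx', hxx'⟩ := exists_par x X'
  obtain ⟨z', hz', hzz'⟩ := exists_par z Z'
  refine point_eq (l := x') (m := z') ?_ (h₁ x x' hXx hYx hx' hxx') (h₂ x x' hXx hYx hx' hxx')
    (k₁ z z' hZz hYz hz' hzz') (k₂ z z' hZz hYz hz' hzz')
  rintro rfl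
  have : x = z := (hxx'.trans hzz'.symm).eq hYx hYz
  subst this
  exact hY (eq_of_mem hXZ hXx hZz hX hZ ▸ hYx)

/-- Two different lines through `X` have parallels through `X'`, and these share only `X'`. -/
theorem SameDir.eq_of_self {X X' Y' : P} (h : SameDir L X X X' Y') : X' = Y' := by
  obtain ⟨Z, hZ⟩ := exists_point_ne L X
  obtain ⟨l, hXl, hZl⟩ := exists_join (L := L) hZ
  obtain ⟨W, hW⟩ := exists_notMem (P := P) l
  obtain ⟨m, hXm, hWm⟩ := exists_line L X W
  obtain ⟨l', hl', hll'⟩ := exists_par l X'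
  obtain ⟨m', hm', hmm'⟩ := exists_par m X'
  refine point_eq (l := l') (m := m') ?_ hl' (h l l' hZl hZl hl' hll') hm'
    (h m m' hXm hXm hm' hmm')
  rintro rfl
  exact hW ((hll'.trans hmm'.symm).eq hZl hXm ▸ hWm)

theorem IsDilatation.comp {f g : P → P} (hg : IsDilatation L g) (hf : IsDilatation L f) :
    IsDilatation L (fun X => g (f X)) :=
  fun X Y => (hf X Y).trans (hg _ _)

/-- Off the line `XY` a value is fixed by the directions from `X` and `Y`. A point of that line is
reached from one of `X`, `Y` and an outside point already settled. -/
theorem IsDilatation.ext {f g : P → P} (hf : IsDilatation L f) (hg : IsDilatation L g) {X Y : P}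
    (hXY : X ≠ Y) (hX : f X = g X) (hY : f Y = g Y) : f = g := by
  obtain ⟨l, hXl, hYl⟩ := exists_join (L := L) hXY
  have off : ∀ Z, Z ∉ l → f Z = g Z := fun Z hZ =>
    SameDir.unique hXY hXl hYl hZ (hf X Z) (hf Y Z) (hX ▸ hg X Z) (hY ▸ hg Y Z)
  obtain ⟨E, hE⟩ := exists_notMem (P := P) l
  funext Z
  by_cases hZ : Z ∈ l
  · obtain ⟨V, hVl, hVZ, hV⟩ : ∃ V : P, V ∈ l ∧ V ≠ Z ∧ f V = g V := by
      by_cases h : X = Z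
      · exact ⟨Y, hYl, fun e => hXY (h.trans e.symm), hY⟩
      · exact ⟨X, hXl, h, hX⟩
    obtain ⟨m, hVm, hEm⟩ := exists_line L V E
    have hZm : Z ∉ m := fun h => hE (eq_of_mem hVZ hVm h hVl hZ ▸ hEm)
    have hVE : V ≠ E := fun h => hE (h ▸ hVl)
    exact SameDir.unique hVE hVm hEm hZm (hf V Z) (hf E Z) (hV ▸ hg V Z) (off E hE ▸ hg E Z)
  · exact off Z hZ

end SameDir

/-! ### Homotheties from the central Desargues axiom -/

section Homothety

variable {P : Type u} {L : Type v} [Membership P L]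

variable (P L) in
/-- Desargues' axiom for triangles in perspective from a point, where two of the three lines
through this point may coincide. -/
def IsCentrallyDesargues : Prop :=
  ∀ (S A B C A' B' C' : P) (a b c : L), a ≠ b → b ≠ c → S ∈ a → S ∈ b → S ∈ c →
    A ∈ a → A' ∈ a → B ∈ b → B' ∈ b → C ∈ c → C' ∈ c →
    A ≠ S → B ≠ S → C ≠ S → A' ≠ S → B' ≠ S → C' ≠ S →
    SameDir L A B A' B' → SameDir L B C B' C' → SameDir L A C A' C'

variable [AffinePlane P L]

/-- The image of `X` under the homothety with centre `S` taking `I` to `A`: the line `SX` meets the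
parallel to `IX` through `A`. -/
theorem exists_homothetic {S I A X : P} {l : L} (hS : S ∈ l) (hI : I ∈ l) (hA : A ∈ l)
    (hIS : I ≠ S) (hAS : A ≠ S) (hX : X ∉ l) :
    ∃ X' : P, X' ≠ S ∧ SameDir L S X S X' ∧ SameDir L I X A X' := by
  obtain ⟨x, hSx, hXx⟩ := exists_line L S X
  obtain ⟨n, hIn, hXn⟩ := exists_line L I X
  obtain ⟨m, hAm, hnm⟩ := exists_par n A
  have hmx : ¬ Parallel (P := P) m x := by
    intro h
    have e : n = x := (hnm.trans h).eq hXn hXx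
    subst e
    exact hX (eq_of_mem hIS hIn hSx hI hS ▸ hXx)
  obtain ⟨X', hXm', hXx'⟩ := exists_meet hmx
  refine ⟨X', ?_, .of_mem (fun e => hX (e ▸ hS)) hSx hXx hSx hXx',
    .of_parallel (fun e => hX (e ▸ hI)) hIn hXn hAm hXm' hnm⟩
  rintro rfl
  have e : m = l := eq_of_mem hAS hAm hXm' hA hS
  subst e
  exact hX (hnm.eq hIn hI ▸ hXn)

theorem IsCentrallyDesargues.exists_homothety (hD : IsCentrallyDesargues P L) {S I A : P} {l : L}
    (hS : S ∈ l) (hI : I ∈ l) (hA : A ∈ l) (hIS : I ≠ S) (hAS : A ≠ S) :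
    ∃ f : P → P, IsDilatation L f ∧ f S = S ∧ f I = A := by
  obtain ⟨E, hE⟩ := exists_notMem (P := P) l
  obtain ⟨E', hES', hSE, hIE⟩ := exists_homothetic hS hI hA hIS hAS hE
  have hES : E ≠ S := fun h => hE (h ▸ hS)
  obtain ⟨e, hSe, hEe⟩ := exists_line L S E
  have hEe' : E' ∈ e := hSE.mem hSe hEe hSe
  have hle : l ≠ e := fun h => hE (h ▸ hEe)
  -- Outside `l` the image is constructed from the pair `I`, `A`. On `l` this fails, so the
  -- auxiliary pair `E`, `E'` replaces it.
  have key : ∀ X : P, ∃ X' : P, (X = S → X' = S) ∧ (X ≠ S → X' ≠ S) ∧ SameDir L S X S X' ∧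
      (X ∉ l → SameDir L I X A X') ∧ (X ∈ l → X ≠ S → SameDir L E X E' X') := by
    intro X
    by_cases hXS : X = S
    · subst hXS
      exact ⟨X, fun _ => rfl, fun h => absurd rfl h, .refl _ _, fun h => absurd hS h,
        fun _ h => absurd rfl h⟩
    by_cases hX : X ∈ l
    · have hXe : X ∉ e := fun h => hXS (point_eq hle hX hS h hSe)
      obtain ⟨X', h1, h2, h3⟩ := exists_homothetic hSe hEe hEe' hES hES' hXe
      exact ⟨X', fun h => absurd h hXS, fun _ => h1, h2, fun h => absurd hX h, fun _ _ => h3⟩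
    · obtain ⟨X', h1, h2, h3⟩ := exists_homothetic hS hI hA hIS hAS hX
      exact ⟨X', fun h => absurd h hXS, fun _ => h1, h2, fun _ => h3, fun h => absurd h hX⟩
  choose f f1 f2 f3 f4 f5 using key
  have fmem : ∀ {X : P} {m : L}, S ∈ m → X ∈ m → f X ∈ m := fun h h' => (f3 _).mem h h' h
  have ne_of : ∀ {X : P}, X ∉ l → X ≠ S := fun h e => h (e ▸ hS)
  -- Desargues with middle vertex `I`. Here `X` and `Y` may lie on one line through `S`, hence the
  -- form of `IsCentrallyDesargues`.
  have off : ∀ X Y : P, X ∉ l → Y ∉ l → SameDir L X Y (f X) (f Y) := by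
    intro X Y hX hY
    obtain ⟨x, hSx, hXx⟩ := exists_line L S X
    obtain ⟨y, hSy, hYy⟩ := exists_line L S Y
    exact hD S X I Y (f X) A (f Y) x l y (fun h => hX (h ▸ hXx)) (fun h => hY (h ▸ hYy)) hSx hS hSy
      hXx (fmem hSx hXx) hI hA hYy (fmem hSy hYy) (ne_of hX) hIS (ne_of hY) (f2 X (ne_of hX)) hAS
      (f2 Y (ne_of hY)) (f4 X hX).swap (f4 Y hY)
  have hfE : f E = E' :=
    SameDir.unique hIS hI hS hE (f4 E hE) (f3 E) hIE hSE
  have mixed : ∀ X Y : P, X ∈ l → Y ∉ l → SameDir L X Y (f X) (f Y) := by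
    intro X Y hX hY
    obtain ⟨y, hSy, hYy⟩ := exists_line L S Y
    have hly : l ≠ y := fun h => hY (h ▸ hYy)
    by_cases hXS : X = S
    · subst hXS
      rw [f1 X rfl]
      exact f3 Y
    -- the case of a point outside `OE`
    have step : ∀ Y : P, ∀ y : L, Y ∉ l → S ∈ y → Y ∈ y → e ≠ y → SameDir L X Y (f X) (f Y) := by
      intro Y y hY hSy hYy hey
      exact hD S X E Y (f X) (f E) (f Y) l e y hle hey hS hSe hSy hX (fmem hS hX) hEe
        (fmem hSe hEe) hYy (fmem hSy hYy) hXS hES (ne_of hY) (f2 X hXS) (f2 E hES)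
        (f2 Y (ne_of hY)) (hfE.symm ▸ (f5 X hX hXS).swap) (off E Y hE hY)
    by_cases hey : e = y
    -- For `Y` on `OE`, that is on `e`, the vertex `E` cannot serve as the middle one; a point `G`
    -- on a third line through `S` does.
    · obtain ⟨G, hGl, hGe⟩ := exists_third_ray hS hSe hle
      obtain ⟨g, hSg, hGg⟩ := exists_line L S G
      have heg : e ≠ g := fun h => hGe (h ▸ hGg)
      exact hD S X G Y (f X) (f G) (f Y) l g y (fun h => hGl (h ▸ hGg))
        (fun h => heg (hey.trans h.symm)) hS hSg hSy
        hX (fmem hS hX) hGg (fmem hSg hGg) hYy (fmem hSy hYy) hXS (ne_of hGl) (ne_of hY) (f2 X hXS)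
        (f2 G (ne_of hGl)) (f2 Y (ne_of hY)) (step G g hGl hSg hGg heg) (off G Y hGl hY)
    · exact step Y y hY hSy hYy hey
  refine ⟨f, fun X Y => ?_, f1 S rfl, ?_⟩
  · by_cases hX : X ∈ l
    · by_cases hY : Y ∈ l
      · by_cases hXY : X = Y
        · subst hXY
          exact .refl _ _
        · exact .of_mem hXY hX hY (fmem hS hX) (fmem hS hY)
      · exact mixed X Y hX hY
    · by_cases hY : Y ∈ l
      · exact (mixed Y X hY hX).swap
      · exact off X Y hX hY
  · have hIe : I ∉ e := fun h => hIS (point_eq hle hI hS h hSe)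
    exact SameDir.unique hES hEe hSe hIe (f5 I hI hIS) (f3 I) hIE.swap
      (.of_mem hIS.symm hS hI hS hA)

end Homothety
-- Pappus implies central Desargues
section Hessenberg

variable {P : Type u} {L : Type v} [Membership P L] [AffinePlane P L]

/-- If `a = c`, the third pair of sides lies on one line, or `A = C` and the two known directions
force `A' = C'`. -/
theorem IsCentrallyDesargues.of_distinct
    (h : ∀ (S A B C A' B' C' : P) (a b c ab bc ac ab' bc' ac' : L), a ≠ b → b ≠ c → a ≠ c →
      S ∈ a → S ∈ b → S ∈ c → A ∈ a → A' ∈ a → B ∈ b → B' ∈ b → C ∈ c → C' ∈ c →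
      A ≠ S → B ≠ S → C ≠ S → A' ≠ S → B' ≠ S → C' ≠ S →
      A ∈ ab → B ∈ ab → B ∈ bc → C ∈ bc → A ∈ ac → C ∈ ac →
      A' ∈ ab' → B' ∈ ab' → B' ∈ bc' → C' ∈ bc' → A' ∈ ac' → C' ∈ ac' →
      Parallel (P := P) ab ab' → Parallel (P := P) bc bc' → Parallel (P := P) ac ac') :
    IsCentrallyDesargues P L := by
  intro S A B C A' B' C' a b c hab hbc hSa hSb hSc hA hA' hB hB' hC hC' hAS hBS hCS hAS' hBS' hCS'
    h₁ h₂
  by_cases hac : a = c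
  · subst hac
    by_cases hAC : A = C
    · subst hAC
      have : A' = C' :=
        SameDir.unique hBS hB hSb (fun k => hAS (point_eq hab hA hSa k hSb)) h₁.swap
          (.of_mem hAS.symm hSa hA hSa hA') h₂ (.of_mem hAS.symm hSa hA hSa hC')
      subst this
      exact .refl _ _
    · exact .of_mem hAC hA hC hA' hC'
  · obtain ⟨ab, hAab, hBab⟩ := exists_line L A B
    obtain ⟨bc, hBbc, hCbc⟩ := exists_line L B C
    obtain ⟨ac, hAac, hCac⟩ := exists_line L A C
    obtain ⟨ab', hAab', hpab⟩ := exists_par ab A'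
    obtain ⟨bc', hBbc', hpbc⟩ := exists_par bc B'
    obtain ⟨ac', hAac', hCac'⟩ := exists_line L A' C'
    have hAC : A ≠ C := fun e => hAS (point_eq hac hA hSa (e ▸ hC) hSc)
    exact .of_parallel hAC hAac hCac hAac' hCac' (h S A B C A' B' C' a b c ab bc ac ab' bc' ac'
      hab hbc hac hSa hSb hSc hA hA' hB hB' hC hC' hAS hBS hCS hAS' hBS' hCS'
      hAab hBab hBbc hCbc hAac hCac hAab' (h₁ ab ab' hAab hBab hAab' hpab) hBbc'
      (h₂ bc bc' hBbc hCbc hBbc' hpbc) hAac' hCac' hpab hpbc)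

theorem IsDesargues.isCentrallyDesargues (h : IsDesargues P L) : IsCentrallyDesargues P L := by
  refine .of_distinct fun S A B C A' B' C' a b c ab bc ac ab' bc' ac' hab hbc hac hSa hSb hSc
    hA hA' hB hB' hC hC' hAS hBS hCS hAS' hBS' hCS' => ?_
  exact h A B C A' B' C' a b c ab bc ac ab' bc' ac' hab hbc hac hA hA' hB hB' hC hC'
    (Or.inr ⟨S, hSa, hSb, hSc, hAS, hBS, hCS, hAS', hBS', hCS'⟩)

/-- Hessenberg's theorem for two proper triangles in general position. -/
theorem IsPappus.parallel_of_perspective (h : IsPappus P L) {S A B C A' B' C' : P}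
    {a b c ab bc ac ab' bc' ac' : L} (hab : a ≠ b) (hbc : b ≠ c) (hac : a ≠ c)
    (hSa : S ∈ a) (hSb : S ∈ b) (hSc : S ∈ c) (hA : A ∈ a) (hA' : A' ∈ a) (hB : B ∈ b)
    (hB' : B' ∈ b) (hC : C ∈ c) (hC' : C' ∈ c) (hAS : A ≠ S) (hBS : B ≠ S)
    (hAS' : A' ≠ S) (hBS' : B' ≠ S) (hCS' : C' ≠ S)
    (hAab : A ∈ ab) (hBab : B ∈ ab) (hBbc : B ∈ bc) (hCbc : C ∈ bc) (hAac : A ∈ ac)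
    (hCac : C ∈ ac) (hAab' : A' ∈ ab') (hBab' : B' ∈ ab') (hBbc' : B' ∈ bc') (hCbc' : C' ∈ bc')
    (hAac' : A' ∈ ac') (hCac' : C' ∈ ac') (hpab : Parallel (P := P) ab ab')
    (hpbc : Parallel (P := P) bc bc') (hCab : C ∉ ab) (hAA' : A ≠ A')
    (hnp : ¬ Parallel (P := P) ac' b) : Parallel (P := P) ac ac' := by
  have off : ∀ {x y : L} {X : P}, x ≠ y → S ∈ x → S ∈ y → X ∈ x → X ≠ S → X ∉ y :=
    fun hxy h1 h2 h3 h4 h5 => h4 (point_eq hxy h3 h1 h5 h2)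
  have hAb := off hab hSa hSb hA hAS
  have hAc := off hac hSa hSc hA hAS
  have hAc' := off hac hSa hSc hA' hAS'
  have hAb' := off hab hSa hSb hA' hAS'
  have hBa := off hab.symm hSb hSa hB hBS
  have hBa' := off hab.symm hSb hSa hB' hBS'
  have hBc := off hbc hSb hSc hB hBS
  have hBc' := off hbc hSb hSc hB' hBS'
  have hCa' := off hac.symm hSc hSa hC' hCS'
  have hCb' := off hbc.symm hSc hSb hC' hCS'
  -- With `p` parallel to `b` through `A`, set `D = A'C' ∩ p`, `M = p ∩ c` and `N = DB' ∩ AB`. Three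
  -- applications of Pappus give `SN ∥ A'C'`, then `B'C' ∥ MN`, then `AC ∥ SN`.
  obtain ⟨p, hAp, hbp⟩ := exists_par b A
  have hbp' : ∀ {X : P}, X ∈ b → X ∉ p := fun h1 h2 => hAb (hbp.eq h1 h2 ▸ hAp)
  obtain ⟨D, hDac', hDp⟩ := exists_meet (l := ac') (m := p) fun k => hnp (k.trans hbp.symm)
  obtain ⟨M, hMp, hMc⟩ := exists_meet (l := p) (m := c)
    fun k => hbc ((hbp.trans k).eq hSb hSc)
  obtain ⟨q, hDq, hBq'⟩ := exists_line L D B'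
  have hDA' : D ≠ A' := fun e => hAA' (point_eq (l := p) (m := a)
    (fun k => hbp' hSb (k ▸ hSa)) hAp (e ▸ hDp) hA hA')
  have hne_ab' : A' ≠ B' := fun e => hAb' (e ▸ hB')
  have hne_bc' : B' ≠ C' := fun e => hBc' (e ▸ hC')
  have hBac' : B' ∉ ac' := by
    intro k
    have e : ac' = ab' := eq_of_mem hne_ab' hAac' k hAab' hBab'
    subst e
    have e : bc' = ac' := eq_of_mem hne_bc' hBbc' hCbc' k hCac'
    subst e
    exact hCab ((hpab.trans hpbc.symm).eq hBab hBbc ▸ hCbc)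
  have hAq' : A' ∉ q := fun k => hBac' (eq_of_mem hDA' hDq k hDac' hAac' ▸ hBq')
  obtain ⟨N, hNq, hNab⟩ := exists_meet (l := q) (m := ab)
    fun k => hAq' ((k.trans hpab).eq hBq' hBab' ▸ hAab')
  have hAq : A ∉ q := by
    intro k
    by_cases e : A = D
    · exact hCa' (eq_of_mem hAA' (e ▸ hDac') hAac' hA hA' ▸ hCac')
    · exact hbp' hB' (eq_of_mem e k hDq hAp hDp ▸ hBq')
  have hSq : S ∉ q := fun k => hbp' (eq_of_mem hBS' hBq' k hB' hSb ▸ hDq) hDp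
  have hDa : D ∉ a := fun k => hCa' (eq_of_mem hDA' hDac' hAac' k hA' ▸ hCac')
  have hNa : N ∉ a := fun k => hAq (point_eq (l := ab) (m := a) (fun e => hBa (e ▸ hBab))
    hNab hAab k hA ▸ hNq)
  obtain ⟨s, hSs, hNs⟩ := exists_line L S N
  -- Pappus for `S, A, A'` on `a` and `D, B', N` on `q`.
  have hs : Parallel (P := P) s ac' :=
    h S A A' D B' N a q b p ab ab' s ac' hSa hA hA' hSq hAq hAq' hDq hBq' hNq hDa hBa' hNa
      hSb hB' hDp hAp hAab hNab hBab' hAab' hSs hNs hDac' hAac' hbp hpab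
  have hSab : S ∉ ab := fun k => hBa (eq_of_mem hAS hAab k hA hSa ▸ hBab)
  have hNc : N ∉ c := by
    intro k
    have e : s = c := eq_of_mem (fun e : N = S => hSab (e ▸ hNab)) hNs hSs k hSc
    exact hAc' ((e ▸ hs).eq hC' hCac' ▸ hAac')
  have hMab : M ∉ ab := fun k => hbp' hB
    (eq_of_mem (fun e : M = A => hAc (e ▸ hMc)) k hAab hMp hAp ▸ hBab)
  obtain ⟨t, hMt, hNt, ht⟩ : ∃ t : L, M ∈ t ∧ N ∈ t ∧ Parallel (P := P) bc' t := by
    -- If `D` lies on `c`, then `D = C' = M` and `MN` is `B'C'` itself; otherwise Pappus applies to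
    -- `B', D, N` on `q` and `M, S, C'` on `c`.
    by_cases hDc : D ∈ c
    · have e₁ : D = C' := point_eq (l := ac') (m := c) (fun e => hAc' (e ▸ hAac'))
        hDac' hCac' hDc hC'
      have e₂ : M = D := point_eq (l := p) (m := c) (fun e => hAc (e ▸ hAp)) hMp hDp hMc hDc
      exact ⟨q, e₂ ▸ hDq, hNq, Or.inl (eq_of_mem hne_bc' hBbc' hCbc' hBq' (e₁ ▸ hDq))⟩
    · have hMq : M ∉ q := fun k => hbp' hB'
        (eq_of_mem (fun e : M = D => hDc (e ▸ hMc)) k hDq hMp hDp ▸ hBq')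
      have hCq' : C' ∉ q := fun k => hAq'
        (eq_of_mem (fun e : C' = D => hDc (e ▸ hC')) k hDq hCac' hDac' ▸ hAac')
      obtain ⟨t, hMt, hNt⟩ := exists_line L M N
      exact ⟨t, hMt, hNt, h B' D N M S C' q c b p ac' s bc' t hBq' hDq hNq hBc' hDc hNc hMc hSc hC'
        hMq hSq hCq' hB' hSb hMp hDp hDac' hCac' hSs hNs hBbc' hCbc' hMt hNt hbp hs.symm⟩
  have hs' : Parallel (P := P) ac s :=
    h A B N S M C ab c p b bc t ac s hAab hBab hNab hAc hBc hNc hSc hMc hC hSab hMab hCab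
      hAp hMp hSb hB hBbc hCbc hMt hNt hAac hCac hSs hNs hbp.symm (hpbc.trans ht)
  exact hs'.trans hs

/-- Hessenberg's theorem for triangles in perspective from a point. -/
theorem IsPappus.isCentrallyDesargues (h : IsPappus P L) : IsCentrallyDesargues P L := by
  refine .of_distinct fun S A B C A' B' C' a b c ab bc ac ab' bc' ac' hab hbc hac hSa hSb hSc
    hA hA' hB hB' hC hC' hAS hBS hCS hAS' hBS' hCS' hAab hBab hBbc hCbc hAac hCac
    hAab' hBab' hBbc' hCbc' hAac' hCac' hpab hpbc => ?_
  have off : ∀ {x y : L} {X : P}, x ≠ y → S ∈ x → S ∈ y → X ∈ x → X ≠ S → X ∉ y :=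
    fun hxy h1 h2 h3 h4 h5 => h4 (point_eq hxy h3 h1 h5 h2)
  have hAb := off hab hSa hSb hA hAS
  have hAb' := off hab hSa hSb hA' hAS'
  have hCa := off hac.symm hSc hSa hC hCS
  have hCb := off hbc.symm hSc hSb hC hCS
  have hCa' := off hac.symm hSc hSa hC' hCS'
  have hCb' := off hbc.symm hSc hSb hC' hCS'
  have collinear : ∀ {A B C A' B' C' : P} {ab bc ac ab' bc' ac' : L}, A ≠ C → B ≠ C → A' ≠ C' →
      B' ≠ C' → A ∈ ab → B ∈ ab → B ∈ bc → C ∈ bc → A ∈ ac → C ∈ ac → A' ∈ ab' → B' ∈ ab' →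
      B' ∈ bc' → C' ∈ bc' → A' ∈ ac' → C' ∈ ac' → Parallel (P := P) ab ab' →
      Parallel (P := P) bc bc' → C ∈ ab → Parallel (P := P) ac ac' := by
    intro A B C A' B' C' ab bc ac ab' bc' ac' h1 h2 h3 h4 k1 k2 k3 k4 k5 k6 m1 m2 m3 m4 m5 m6
      p1 p2 hC
    have e1 : ac = ab := eq_of_mem h1 k5 k6 k1 hC
    have e2 : bc = ab := eq_of_mem h2 k3 k4 k2 hC
    subst e1 e2
    have e3 : ab' = bc' := (p1.symm.trans p2).eq m2 m3
    subst e3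
    have e4 : ac' = ab' := eq_of_mem h3 m5 m6 m1 m4
    subst e4
    exact p1
  have nAC : A ≠ C := fun e => hCa (e ▸ hA)
  have nBC : B ≠ C := fun e => hCb (e ▸ hB)
  have nAC' : A' ≠ C' := fun e => hCa' (e ▸ hA')
  have nBC' : B' ≠ C' := fun e => hCb' (e ▸ hB')
  by_cases hCab : C ∈ ab
  · exact collinear nAC nBC nAC' nBC' hAab hBab hBbc hCbc hAac hCac hAab' hBab' hBbc' hCbc' hAac'
      hCac' hpab hpbc hCab
  by_cases hCab' : C' ∈ ab'
  · exact (collinear nAC' nBC' nAC nBC hAab' hBab' hBbc' hCbc' hAac' hCac' hAab hBab hBbc hCbc hAac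
      hCac hpab.symm hpbc.symm hCab').symm
  by_cases hAA' : A = A'
  · subst hAA'
    have e1 : ab = ab' := hpab.eq hAab hAab'
    subst e1
    have e2 : B = B' := point_eq (l := ab) (m := b) (fun e => hAb (e ▸ hAab)) hBab hBab' hB hB'
    subst e2
    have e3 : bc = bc' := hpbc.eq hBbc hBbc'
    subst e3
    have e4 : C = C' := point_eq (l := c) (m := bc)
      (fun e => off hbc hSb hSc hB hBS (e ▸ hBbc)) hC hC' hCbc hCbc'
    subst e4
    exact Or.inl (eq_of_mem nAC hAac hCac hAac' hCac')
  -- The auxiliary point `D` needs `A'C'` not parallel to `b`. If it is parallel, either `AC` is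
  -- too, or the triangles exchange roles.
  by_cases hnp' : Parallel (P := P) ac' b
  · by_cases hnp : Parallel (P := P) ac b
    · exact hnp.trans hnp'.symm
    · exact (h.parallel_of_perspective hab hbc hac hSa hSb hSc hA' hA hB' hB hC' hC hAS' hBS'
        hAS hBS hCS hAab' hBab' hBbc' hCbc' hAac' hCac' hAab hBab hBbc hCbc hAac hCac hpab.symm
        hpbc.symm hCab' (Ne.symm hAA') hnp).symm
  · exact h.parallel_of_perspective hab hbc hac hSa hSb hSc hA hA' hB hB' hC hC' hAS hBS
      hAS' hBS' hCS' hAab hBab hBbc hCbc hAac hCac hAab' hBab' hBbc' hCbc' hAac' hCac' hpab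
      hpbc hCab hAA' hnp'

end Hessenberg
-- Translations
section Translation

variable {P : Type u} {L : Type v} [Membership P L]

variable (L) in
/-- A dilatation that moves all points in the same direction. -/
structure IsTranslation (f : P → P) : Prop where
  isDilatation : IsDilatation L f
  sameDir : ∀ X Y : P, SameDir L X (f X) Y (f Y)

theorem IsTranslation.id : IsTranslation L (fun X : P => X) :=
  ⟨.id, fun X Y => .refl X Y⟩

variable [AffinePlane P L]

theorem IsTranslation.eq_of_fixed {f : P → P} (hf : IsTranslation L f) {X : P} (hX : f X = X) :
    f = fun Y => Y := by
  funext Y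
  have h := hf.sameDir X Y
  rw [hX] at h
  exact h.eq_of_self.symm

/-- Each line joining a point to its image is mapped into itself, so a common point of two different
such lines would be fixed. -/
theorem IsDilatation.isTranslation {f : P → P} (hf : IsDilatation L f) (h : ∀ X, f X ≠ X) :
    IsTranslation L f := by
  refine ⟨hf, fun X Y => ?_⟩
  obtain ⟨l, hXl, hfXl⟩ := exists_line L X (f X)
  obtain ⟨m, hYm, hfYm⟩ := exists_line L Y (f Y)
  refine .of_parallel (h X).symm hXl hfXl hYm hfYm ?_
  by_contra hlm
  obtain ⟨W, hWl, hWm⟩ := exists_meet hlm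
  have hfl : f W ∈ l := (hf X W).mem hXl hWl hfXl
  have hfm : f W ∈ m := (hf Y W).mem hYm hWm hfYm
  exact h W (point_eq (fun e => hlm (Or.inl e)) hfl hWl hfm hWm)

theorem IsTranslation.ext {f g : P → P} (hf : IsTranslation L f) (hg : IsTranslation L g) {X : P}
    (h : f X = g X) : f = g := by
  by_cases hX : f X = X
  · rw [hf.eq_of_fixed hX, hg.eq_of_fixed (h.symm.trans hX)]
  obtain ⟨l, hXl, hfl⟩ := exists_line L X (f X)
  obtain ⟨Y, hY⟩ := exists_notMem (P := P) l
  have hXY : X ≠ Y := fun e => hY (e ▸ hXl)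
  refine hf.isDilatation.ext hg.isDilatation hXY h ?_
  obtain ⟨n, hXn, hYn⟩ := exists_line L X Y
  obtain ⟨n', hn', hnn'⟩ := exists_par n (f X)
  obtain ⟨m, hYm, hlm⟩ := exists_par l Y
  refine point_eq (l := m) (m := n') ?_ (hf.sameDir X Y l m hXl hfl hYm hlm)
    (hg.sameDir X Y l m hXl (h ▸ hfl) hYm hlm) (hf.isDilatation X Y n n' hXn hYn hn' hnn')
    (hg.isDilatation X Y n n' hXn hYn (h ▸ hn') hnn')
  rintro rfl
  exact hY ((hlm.trans hnn'.symm).eq hXl hXn ▸ hYn)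

/-- If the composite fixes `X` and `f` moves it, a point `Y` off the line `X f(X)` keeps to its
parallel to that line and to `XY`, so it is fixed too and the composite is the identity. -/
theorem IsTranslation.comp {f g : P → P} (hg : IsTranslation L g) (hf : IsTranslation L f) :
    IsTranslation L (fun X => g (f X)) := by
  have hd := hg.isDilatation.comp hf.isDilatation
  by_cases hfix : ∃ X, g (f X) = X
  · obtain ⟨X, hX⟩ := hfix
    suffices (fun X => g (f X)) = fun X => X from this ▸ .id
    by_cases hfX : f X = X
    · have hgX : g X = X := by rwa [hfX] at hX
      funext Y
      simp [hf.eq_of_fixed hfX, hg.eq_of_fixed hgX]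
    · obtain ⟨l, hXl, hfl⟩ := exists_line L X (f X)
      obtain ⟨Y, hY⟩ := exists_notMem (P := P) l
      have hXY : X ≠ Y := fun e => hY (e ▸ hXl)
      refine hd.ext .id hXY hX ?_
      obtain ⟨n, hXn, hYn⟩ := exists_line L X Y
      obtain ⟨m, hYm, hlm⟩ := exists_par l Y
      have hfm : f Y ∈ m := hf.sameDir X Y l m hXl hfl hYm hlm
      refine point_eq (l := m) (m := n) ?_
        (hg.sameDir (f X) (f Y) l m hfl (hX.symm ▸ hXl) hfm hlm) hYm
        ((hd X Y).mem hXn hYn (by simpa only [hX] using hXn)) hYn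
      rintro rfl
      exact hY (hlm.eq hXl hXn ▸ hYm)
  · exact hd.isTranslation fun X hX => hfix ⟨X, hX⟩

/-- A translation is obtained by composing two homotheties. -/
theorem IsCentrallyDesargues.exists_translation (hD : IsCentrallyDesargues P L)
    (h3 : ∀ (l : L) (U V : P), ∃ W : P, W ∈ l ∧ W ≠ U ∧ W ≠ V) (A B : P) :
    ∃ f : P → P, IsTranslation L f ∧ f A = B := by
  by_cases hAB : A = B
  · exact ⟨fun X => X, .id, hAB⟩
  obtain ⟨l, hAl, hBl⟩ := exists_join (L := L) hAB
  obtain ⟨X, hX⟩ := exists_notMem (P := P) l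
  obtain ⟨n, hAn, hXn⟩ := exists_line L A X
  obtain ⟨m, hXm, hlm⟩ := exists_par l X
  obtain ⟨k, hBk, hnk⟩ := exists_par n B
  have hnl : n ≠ l := fun e => hX (e ▸ hXn)
  have hlm' : ∀ {Z : P}, Z ∈ l → Z ∉ m := fun h1 h2 => hX (hlm.eq h1 h2 ▸ hXm)
  -- `Y` completes the parallelogram on `A`, `B`, `X`, so it must be the image of `X`.
  obtain ⟨Y, hYm, hYk⟩ := exists_meet (l := m) (m := k)
    fun e => hnl (((hlm.trans e).trans hnk.symm).symm.eq hAn hAl)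
  -- The first homothety, with centre `B`, takes `A` to `C`; as `C ≠ A`, it moves `X` off `m`.
  obtain ⟨C, hCl, hCA, hCB⟩ := h3 l A B
  obtain ⟨h₁, d₁, hB₁, hA₁⟩ := hD.exists_homothety hBl hAl hCl hAB hCB
  obtain ⟨k', hCk', hnk'⟩ := exists_par n C
  have hkk' : k ≠ k' := by
    rintro rfl
    have e : k = l := eq_of_mem hCB hCk' hBk hCl hBl
    subst e
    exact hnl (hnk.eq hAn hAl)
  obtain ⟨x, hBx, hXx⟩ := exists_line L B X
  have hZx : h₁ X ∈ x := (d₁ B X).mem hBx hXx (hB₁.symm ▸ hBx)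
  have hZk' : h₁ X ∈ k' := d₁ A X n k' hAn hXn (hA₁.symm ▸ hCk') hnk'
  have hZm : h₁ X ∉ m := by
    intro h
    have e : h₁ X = X := point_eq (l := m) (m := x) (fun e => hlm' hBl (e ▸ hBx)) h hXm hZx hXx
    have := d₁.ext .id (fun e : B = X => hX (e ▸ hBl)) hB₁ e
    exact hCA (hA₁.symm.trans (congrFun this A))
  obtain ⟨z, hZz, hYz⟩ := exists_line L (h₁ X) Y
  -- The second homothety must take `C` to `B` and `h₁ X` to `Y`, which leaves only this centre.
  obtain ⟨W, hWz, hWl⟩ := exists_meet (l := z) (m := l)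
    fun e => not_parallel_of_mem hYz hYm hZz hZm (e.trans hlm)
  have hWB : W ≠ B := by
    rintro rfl
    have e : z = k := eq_of_mem (fun e : W = Y => hlm' hBl (e ▸ hYm)) hWz hYz hBk hYk
    subst e
    exact hkk' ((hnk.symm.trans hnk').eq hZz hZk')
  have hWC : W ≠ C := by
    rintro rfl
    have hWZ : W ≠ h₁ X := by
      intro e
      have hZB : h₁ X = B := point_eq (l := x) (m := l) (fun e => hX (e ▸ hXx)) hZx hBx
        (e ▸ hWl) hBl
      exact hCB (e.trans hZB)
    have e : z = k' := eq_of_mem hWZ hWz hZz hCk' hZk'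
    subst e
    exact hkk' ((hnk.symm.trans hnk').eq hYk hYz)
  obtain ⟨h₂, d₂, hW₂, hC₂⟩ := hD.exists_homothety hWl hCl hBl hWC.symm hWB.symm
  have hY₂ : h₂ (h₁ X) = Y := by
    refine point_eq (l := z) (m := k) ?_ ((d₂ W _).mem hWz hZz (hW₂.symm ▸ hWz)) hYz
      (d₂ C _ k' k hCk' hZk' (hC₂.symm ▸ hBk) (hnk'.symm.trans hnk)) hYk
    rintro rfl
    have e : z = l := eq_of_mem hWB hWz hBk hWl hBl
    subst e
    exact hlm' hYz hYm
  have d := d₂.comp d₁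
  have hA : h₂ (h₁ A) = B := hA₁.symm ▸ hC₂
  -- Lines through a fixed point `V` are preserved: for `V` on `l`, the line `VX` would be `m`,
  -- which misses `l`; otherwise `VA` would be `l`.
  refine ⟨_, d.isTranslation fun V hV => ?_, hA⟩
  by_cases hVl : V ∈ l
  · obtain ⟨v, hVv, hXv⟩ := exists_line L V X
    have hYv : Y ∈ v := hY₂ ▸ (d V X).mem hVv hXv (by simpa only [hV] using hVv)
    have hXY : X ≠ Y := by
      rintro rfl
      have e : n = k := hnk.eq hXn hYk
      subst e
      exact hnl (eq_of_mem hAB hAn hBk hAl hBl)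
    exact hlm' hVl (eq_of_mem hXY hXv hYv hXm hYm ▸ hVv)
  · obtain ⟨v, hVv, hAv⟩ := exists_line L V A
    have hBv : B ∈ v := hA ▸ (d V A).mem hVv hAv (by simpa only [hV] using hVv)
    exact hVl (eq_of_mem hAB hAv hBv hAl hBl ▸ hVv)

end Translation
-- The division ring of the line OI
section Algebra

/-- A division ring from its operations. -/
@[reducible]
def divisionRingOfOperations {α : Type*} (add mul : α → α → α) (zero one : α) (neg inv : α → α)
    (add_assoc : ∀ a b c, add (add a b) c = add a (add b c)) (zero_add : ∀ a, add zero a = a)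
    (neg_add : ∀ a, add (neg a) a = zero)
    (mul_assoc : ∀ a b c, mul (mul a b) c = mul a (mul b c)) (one_mul : ∀ a, mul one a = a)
    (mul_one : ∀ a, mul a one = a) (left_distrib : ∀ a b c, mul a (add b c) =
      add (mul a b) (mul a c)) (right_distrib : ∀ a b c, mul (add a b) c = add (mul a c) (mul b c))
    (one_ne : one ≠ zero) (mul_inv : ∀ a, a ≠ zero → mul a (inv a) = one)
    (inv_zero : inv zero = zero) : DivisionRing α :=
  letI : Add α := ⟨add⟩
  letI : Mul α := ⟨mul⟩
  letI : Zero α := ⟨zero⟩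
  letI : One α := ⟨one⟩
  letI : Neg α := ⟨neg⟩
  letI : Ring α := Ring.ofMinimalAxioms add_assoc zero_add neg_add mul_assoc one_mul mul_one
    left_distrib right_distrib
  { inv := inv
    exists_pair_ne := ⟨one, zero, one_ne⟩
    mul_inv_cancel := mul_inv
    inv_zero := inv_zero
    nnqsmul := _
    nnqsmul_def := fun _ _ => rfl
    qsmul := _
    qsmul_def := fun _ _ => rfl }

end Algebra

section Coordinates

variable {P : Type u} {L : Type v} [Membership P L] [AffinePlane P L]

namespace Frame

variable {F : Frame P L}

theorem sumVia_spec (E : F.Off) (A B : F.Pt) :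
    ∃ X : P, X ∈ par F.line E.1 ∧ X ∈ par (ray F.zero E : L) A.1 ∧
      (sumVia E A B).1 ∈ par (ray B E : L) X :=
  ⟨_, meet_mem_left (not_parallel_add F.zero A E), meet_mem_right _,
    meet_mem_left (not_parallel_par_ray B E _)⟩

theorem prodVia_spec (E : F.Off) (A B : F.Pt) :
    ∃ X : P, X ∈ par (ray F.one E : L) A.1 ∧ X ∈ (ray F.zero E : L) ∧
      (prodVia E A B).1 ∈ par (ray B E : L) X :=
  ⟨_, meet_mem_left (not_parallel_mul A E), meet_mem_right _,
    meet_mem_left (not_parallel_par_ray B E _)⟩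

theorem eq_of_mem_par_ray {E : F.Off} {B C D : F.Pt} {X : P} (hC : C.1 ∈ par (ray B E : L) X)
    (hD : D.1 ∈ par (ray B E : L) X) : C = D :=
  Subtype.ext (point_eq (fun e => not_parallel_par_ray B E X (Or.inl e)) hC hD C.2 D.2)

/-- The two lines defining P₁ are the parallel to OI through E and the parallel to OE through A;
f(E) lies on both. -/
theorem sumVia_eq {f : P → P} (hf : IsTranslation L f) {A B : F.Pt} (hA : f F.O = A.1)
    (hB : f B.1 ∈ F.line) (E : F.Off) : sumVia E A B = ⟨f B.1, hB⟩ := by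
  obtain ⟨X, h₁, h₂, h₃⟩ := sumVia_spec E A B
  have h : X = f E.1 := point_eq (fun e => not_parallel_add F.zero A E (Or.inl e)) h₁
    (hf.sameDir F.O E.1 F.line _ F.O_mem (hA ▸ A.2) (mem_par _ _) (parallel_par _ _)) h₂
    (hf.isDilatation F.O E.1 (ray F.zero E) _ (left_mem_join _) (right_mem_join _)
      (hA ▸ mem_par _ _) (parallel_par _ _))
  subst h
  exact eq_of_mem_par_ray h₃ (hf.isDilatation E.1 B.1 (ray B E) _ (right_mem_join _)
    (left_mem_join _) (mem_par _ _) (parallel_par _ _))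

theorem prodVia_eq {f : P → P} (hf : IsDilatation L f) {A B : F.Pt} (hO : f F.O = F.O)
    (hI : f F.I = A.1) (hB : f B.1 ∈ F.line) (E : F.Off) : prodVia E A B = ⟨f B.1, hB⟩ := by
  obtain ⟨X, h₁, h₂, h₃⟩ := prodVia_spec E A B
  have h : X = f E.1 := point_eq (fun e => not_parallel_mul A E (Or.inl e)) h₁
    (hf F.I E.1 (ray F.one E) _ (left_mem_join _) (right_mem_join _)
      (hI ▸ mem_par _ _) (parallel_par _ _)) h₂
    ((hf F.O E.1).mem (left_mem_join (ne_off F.zero E)) (right_mem_join (ne_off F.zero E))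
      (hO.symm ▸ left_mem_join (ne_off F.zero E)))
  subst h
  exact eq_of_mem_par_ray h₃ (hf E.1 B.1 (ray B E) _ (right_mem_join _) (left_mem_join _)
    (mem_par _ _) (parallel_par _ _))

/-- The points of the line `OI` form a division ring if there are at least three of them. -/
theorem exists_divisionRing (hD : IsCentrallyDesargues P L)
    (h3 : ∀ (l : L) (U V : P), ∃ W : P, W ∈ l ∧ W ≠ U ∧ W ≠ V) :
    ∃ _ : DivisionRing F.Pt, (∀ (E : F.Off) (A B : F.Pt), sumVia E A B = A + B) ∧
      (∀ (E : F.Off) (A B : F.Pt), prodVia E A B = A * B) ∧ F.zero = 0 ∧ F.one = 1 := by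
  -- Translations to all points of the plane, not only of OI, are needed for right distributivity.
  choose T hT hTO using fun U : P => hD.exists_translation h3 F.O U
  have hT_unique : ∀ {f : P → P} {U : P}, IsTranslation L f → f F.O = U → T U = f :=
    fun hf h => (hT _).ext hf ((hTO _).trans h.symm)
  have hs : ∀ A : F.Pt, ∃ f : P → P, IsDilatation L f ∧ f F.O = F.O ∧ f F.I = A.1 := by
    intro A
    by_cases hA : A.1 = F.O
    -- The constant map is the dilatation representing multiplication by O.
    · exact ⟨fun _ => F.O, .const _, rfl, hA.symm⟩
    · exact hD.exists_homothety F.O_mem F.I_mem A.2 F.ne.symm hA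
  choose σ hσ hσO hσI using hs
  have hσ_unique : ∀ {f : P → P} {A : F.Pt}, IsDilatation L f → f F.O = F.O → f F.I = A.1 →
      σ A = f :=
    fun hf hO hI => (hσ _).ext hf F.ne ((hσO _).trans hO.symm) ((hσI _).trans hI.symm)
  have hTmem : ∀ A B : F.Pt, T A.1 B.1 ∈ F.line := fun A B =>
    ((hT A.1).isDilatation F.O B.1).mem F.O_mem B.2 ((hTO A.1).symm ▸ A.2)
  have hσmem : ∀ A B : F.Pt, σ A B.1 ∈ F.line := fun A B =>
    (hσ A F.O B.1).mem F.O_mem B.2 ((hσO A).symm ▸ F.O_mem)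
  have T_comp : ∀ U V : P, (fun X => T U (T V X)) = T (T U V) := fun U V =>
    (hT_unique ((hT U).comp (hT V)) (by rw [hTO])).symm
  have T_zero : T F.O = fun X => X := hT_unique .id rfl
  have σ_zero : σ F.zero = fun _ => F.O := hσ_unique (.const _) rfl rfl
  have σ_one : σ F.one = fun X => X := hσ_unique .id rfl rfl
  have σ_comp : ∀ A B : F.Pt, (fun X => σ A (σ B X)) = σ ⟨σ A B.1, hσmem A B⟩ := fun A B =>
    (hσ_unique ((hσ A).comp (hσ B)) (by rw [hσO, hσO]) (by rw [hσI])).symm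
  have hneg : ∀ A : F.Pt, ∃ B : F.Pt, T B.1 A.1 = F.O := by
    intro A
    obtain ⟨g, hg, hgA⟩ := hD.exists_translation h3 A.1 F.O
    refine ⟨⟨g F.O, (hg.isDilatation A.1 F.O).mem A.2 F.O_mem (hgA.symm ▸ F.O_mem)⟩, ?_⟩
    rw [hT_unique hg rfl, hgA]
  choose neg hneg using hneg
  have hinv : ∀ A : F.Pt, ∃ B : F.Pt, (A = F.zero → B = F.zero) ∧
      (A ≠ F.zero → (∀ X, σ A (σ B X) = X) ∧ ∀ X, σ B (σ A X) = X) := by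
    intro A
    by_cases hA : A = F.zero
    · exact ⟨F.zero, fun _ => rfl, fun h => absurd hA h⟩
    have hA' : A.1 ≠ F.O := fun e => hA (Subtype.ext e)
    obtain ⟨g, hg, hgO, hgA⟩ := hD.exists_homothety F.O_mem A.2 F.I_mem hA' F.ne.symm
    refine ⟨⟨g F.I, (hg F.O F.I).mem F.O_mem F.I_mem (hgO.symm ▸ F.O_mem)⟩,
      fun h => absurd h hA, fun _ => ?_⟩
    rw [hσ_unique (A := ⟨g F.I, _⟩) hg hgO rfl]
    refine ⟨congrFun (((hσ A).comp hg).ext .id (X := F.O) (Y := A.1) hA'.symm ?_ ?_),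
      congrFun ((hg.comp (hσ A)).ext .id (X := F.O) (Y := F.I) F.ne ?_ ?_)⟩
    · show σ A (g F.O) = F.O
      rw [hgO, hσO]
    · show σ A (g A.1) = A.1
      rw [hgA, hσI]
    · show g (σ A F.O) = F.O
      rw [hσO, hgO]
    · show g (σ A F.I) = F.I
      rw [hσI, hgA]
  choose inv hinv0 hinv using hinv
  -- Conjugating a translation by a homothety gives a translation, here the one taking O to A · B.
  have left_distrib : ∀ (A B : F.Pt) (X : P), σ A (T B.1 X) = T (σ A B.1) (σ A X) := by
    intro A B X
    by_cases hA : A = F.zero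
    · rw [hA, σ_zero, T_zero]
    obtain ⟨h₁, h₂⟩ := hinv A hA
    have d := (hσ A).comp ((hT B.1).isDilatation.comp (hσ (inv A)))
    have t : IsTranslation L fun X => σ A (T B.1 (σ (inv A) X)) := by
      by_cases hfix : ∃ V, T B.1 V = V
      · obtain ⟨V, hV⟩ := hfix
        rw [(hT B.1).eq_of_fixed hV]
        simp only [h₁]
        exact .id
      · refine d.isTranslation fun V hV => hfix ⟨σ (inv A) V, ?_⟩
        have := congrArg (σ (inv A)) hV
        rwa [h₂] at this
    rw [hT_unique t (U := σ A B.1) (by simp only [hσO, hTO])]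
    exact congrArg (fun Y => σ A (T B.1 Y)) (h₂ X).symm
  -- The map X ↦ σ_A(X) + σ_B(X), with the sum formed by translations, is a dilatation fixing O and
  -- taking I to A + B.
  have right_distrib : ∀ (A B : F.Pt) (X : P),
      σ ⟨T A.1 B.1, hTmem A B⟩ X = T (σ A X) (σ B X) := by
    intro A B X
    refine congrFun (hσ_unique (f := fun X => T (σ A X) (σ B X)) ?_ ?_ ?_) X
    · intro X Y l m hX hY hm hlm
      -- Passing from `X` to `Y` in the first summand composes with `δ`, which moves points in the
      -- direction of `XY`.
      obtain ⟨δ, hδ, hδX⟩ := hD.exists_translation h3 (σ A X) (σ A Y)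
      have e : T (σ A Y) = fun Z => δ (T (σ A X) Z) :=
        hT_unique (hδ.comp (hT _)) (by rw [hTO, hδX])
      show T (σ A Y) (σ B Y) ∈ m
      rw [e]
      obtain ⟨n, hn, hln⟩ := exists_par l (σ A X)
      have h : T (σ A X) (σ B Y) ∈ m :=
        ((hσ B X Y).trans ((hT _).isDilatation _ _)) l m hX hY hm hlm
      exact hδ.sameDir (σ A X) _ n m hn (hδX.symm ▸ hσ A X Y l n hX hY hn hln) h
        (hln.symm.trans hlm)
    · simp only [hσO, T_zero]
    · simp only [hσI]
  refine ⟨divisionRingOfOperations (fun A B => ⟨T A.1 B.1, hTmem A B⟩)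
    (fun A B => ⟨σ A B.1, hσmem A B⟩) F.zero F.one neg inv ?_ ?_ ?_ ?_ ?_ ?_ ?_ ?_ ?_ ?_ ?_,
    fun E A B => sumVia_eq (hT A.1) (hTO A.1) (hTmem A B) E,
    fun E A B => prodVia_eq (hσ A) (hσO A) (hσI A) (hσmem A B) E, rfl, rfl⟩
  · exact fun A B C => Subtype.ext (congrFun (T_comp A.1 B.1) C.1).symm
  · exact fun A => Subtype.ext (congrFun T_zero A.1)
  · exact fun A => Subtype.ext (hneg A)
  · exact fun A B C => Subtype.ext (congrFun (σ_comp A B) C.1).symm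
  · exact fun A => Subtype.ext (congrFun σ_one A.1)
  · exact fun A => Subtype.ext (hσI A)
  · exact fun A B C => Subtype.ext (left_distrib A B C.1)
  · exact fun A B C => Subtype.ext (right_distrib A B C.1)
  · exact fun e => F.ne (congrArg Subtype.val e).symm
  · exact fun A hA => Subtype.ext ((congrArg (σ A) (hσI (inv A))).symm.trans ((hinv A hA).1 F.I))
  · exact hinv0 _ rfl

/-- With X and Y the points P₁ of A · B and B · A, and C = A · B, Pappus for A, B, C and Y, X, E
turns AX ∥ YB and BE ∥ XC into AE ∥ YC, so C is also B · A. -/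
theorem prodVia_comm_of_pappus (h : IsPappus P L) (E : F.Off) {A B : F.Pt} (hA : A ≠ F.zero)
    (hB : B ≠ F.zero) : prodVia E A B = prodVia E B A := by
  have hOE : F.O ∈ (ray F.zero E : L) := left_mem_join _
  have hEE : ∀ C : F.Pt, E.1 ∈ (ray C E : L) := fun C => right_mem_join _
  have hmem : ∀ C : F.Pt, C ≠ F.zero → C.1 ∉ (ray F.zero E : L) := fun C hC hm =>
    not_parallel_ray F.zero E (Or.inl (eq_of_mem (fun e => hC (Subtype.ext e)) hm hOE C.2 F.O_mem))
  have off : ∀ {C : F.Pt} {X : P}, C ≠ F.zero → X ∈ par (ray F.one E : L) C.1 →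
      X ∈ (ray F.zero E : L) → X ∉ F.line := fun {C X} hC h₁ h₂ h₃ =>
    hmem C hC (point_eq (fun e => not_parallel_par_ray F.one E C.1 (Or.inl e)) (mem_par _ _) h₁
      C.2 h₃ ▸ h₂)
  obtain ⟨X, hX₁, hX₂, hX⟩ := prodVia_spec E A B
  obtain ⟨Y, hY₁, hY₂, hY⟩ := prodVia_spec E B A
  generalize prodVia E A B = C at *
  have hC : C.1 ∉ (ray F.zero E : L) := by
    intro hm
    have hne : X ≠ C.1 := fun e => off hA hX₁ hX₂ (e ▸ C.2)
    have e := eq_of_mem hne (mem_par _ _) hX hX₂ hm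
    have e' : (ray B E : L) = ray F.zero E :=
      ((parallel_par (ray B E : L) X).eq (hEE B) (e ▸ hEE F.zero)).trans e
    exact hmem B hB (e' ▸ left_mem_join (ne_off B E))
  obtain ⟨s, hCs, hYs⟩ := exists_line L C.1 Y
  have key : Parallel (P := P) (ray A E) s :=
    h A.1 B.1 C.1 Y X E.1 F.line (ray F.zero E) (par (ray F.one E) A.1) (par (ray F.one E) B.1)
      (ray B E) (par (ray B E) X) (ray A E) s A.2 B.2 C.2 (hmem A hA) (hmem B hB) hC hY₂ hX₂
      (hEE _) (off hB hY₁ hY₂) (off hA hX₁ hX₂) E.2 (mem_par _ _) hX₁ hY₁ (mem_par _ _)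
      (left_mem_join _) (hEE _) (mem_par _ _) hX (left_mem_join _) (hEE _) hYs hCs
      ((parallel_par _ _).symm.trans (parallel_par _ _)) (parallel_par _ _)
  exact eq_of_mem_par_ray ((key.symm.trans (parallel_par _ _)).eq hYs (mem_par _ _) ▸ hCs) hY

end Frame

namespace Auxiliary

variable {F : Frame P L} {κ : Auxiliary F} [DivisionRing F.Pt]

theorem neg_eq (hadd : ∀ A B, κ.add A B = A + B) (hzero : F.zero = 0) (A : F.Pt) :
    κ.neg A = -A := by
  have h : κ.add A (κ.neg A) = F.zero ∧ κ.add (κ.neg A) A = F.zero :=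
    Classical.epsilon_spec (p := fun X => κ.add A X = F.zero ∧ κ.add X A = F.zero)
      ⟨-A, by simp [hadd, hzero]⟩
  rw [hadd, hzero] at h
  exact eq_neg_of_add_eq_zero_right h.1

theorem inv_eq (hmul : ∀ A B, κ.mul A B = A * B) (hone : F.one = 1) {A : F.Pt} (hA : A ≠ 0) :
    κ.inv A = A⁻¹ := by
  have h : κ.mul A (κ.inv A) = F.one ∧ κ.mul (κ.inv A) A = F.one :=
    Classical.epsilon_spec (p := fun X => κ.mul A X = F.one ∧ κ.mul X A = F.one)
      ⟨A⁻¹, by simp [hmul, hone, hA]⟩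
  rw [hmul, hone] at h
  exact eq_inv_of_mul_eq_one_right h.1

theorem ratio_eq (hadd : ∀ A B, κ.add A B = A + B) (hmul : ∀ A B, κ.mul A B = A * B)
    (hzero : F.zero = 0) (hone : F.one = 1) (A : F.Pt) {B C : F.Pt} (hBC : B ≠ C) :
    κ.ratio A B C = (B - C)⁻¹ * (A - C) := by
  have hsub : ∀ A B, κ.sub A B = A - B := fun A B => by
    rw [sub, neg_eq hadd hzero, hadd, sub_eq_add_neg]
  rw [ratio, hsub, hsub, inv_eq hmul hone (sub_ne_zero.2 hBC), hmul]

end Auxiliary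

end Coordinates

/-! ### The ratio identities -/

theorem inv_sub_inv_ratio {D : Type*} [DivisionRing D] {A B C : D} (hA : A ≠ 0) (hB : B ≠ 0)
    (hC : C ≠ 0) :
    (B⁻¹ - C⁻¹)⁻¹ * (A⁻¹ - C⁻¹) = B * ((B - C)⁻¹ * (A - C)) * A⁻¹ := by
  have h₁ : B⁻¹ - C⁻¹ = C⁻¹ * (C - B) * B⁻¹ := by
    rw [mul_sub, sub_mul, inv_mul_cancel₀ hC, one_mul, mul_assoc, mul_inv_cancel₀ hB, mul_one]
  have h₂ : A⁻¹ - C⁻¹ = C⁻¹ * (C - A) * A⁻¹ := by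
    rw [mul_sub, sub_mul, inv_mul_cancel₀ hC, one_mul, mul_assoc, mul_inv_cancel₀ hA, mul_one]
  rw [h₁, h₂, mul_inv_rev, mul_inv_rev, inv_inv, inv_inv, ← neg_sub B C, ← neg_sub A C, inv_neg]
  simp only [mul_assoc, mul_inv_cancel_left₀ hC, neg_mul, mul_neg, neg_neg]

end AffinePlane

theorem mainTheorem5 {P : Type u} {L : Type v} [Membership P L] [AffinePlane P L]
    (F : AffinePlane.Frame P L) (κ : AffinePlane.Auxiliary F) :
    (AffinePlane.IsDesargues P L →
      ∀ A B C : F.Pt, A ≠ F.zero → B ≠ F.zero → C ≠ F.zero → A ≠ B → B ≠ C → A ≠ C →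
        κ.ratio (κ.inv A) (κ.inv B) (κ.inv C) = κ.mul (κ.mul B (κ.ratio A B C)) (κ.inv A)) ∧
    (AffinePlane.IsPappus P L →
      ∀ A B C : F.Pt, A ≠ F.zero → B ≠ F.zero → C ≠ F.zero → B ≠ C →
        κ.ratio (κ.inv A) (κ.inv B) (κ.inv C) = κ.mul (κ.ratio A B C) (κ.ratio B A F.zero)) := by
  -- O, B, C are three points of OI, which excludes planes with two points on each line.
  have coord : AffinePlane.IsCentrallyDesargues P L → ∀ B C : F.Pt, B ≠ F.zero → C ≠ F.zero →
      B ≠ C → ∃ _ : DivisionRing F.Pt, (∀ E A B, AffinePlane.Frame.sumVia E A B = A + B) ∧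
        (∀ E A B, AffinePlane.Frame.prodVia E A B = A * B) ∧ F.zero = 0 ∧ F.one = 1 :=
    fun hD B C hB hC hBC => AffinePlane.Frame.exists_divisionRing hD
      (AffinePlane.exists_mem_ne_ne_of_line B.2 C.2 F.zero.2 (fun e => hBC (Subtype.ext e))
        (fun e => hC (Subtype.ext e)) (fun e => hB (Subtype.ext e)))
  have main : AffinePlane.IsCentrallyDesargues P L → ∀ A B C : F.Pt, A ≠ F.zero → B ≠ F.zero →
      C ≠ F.zero → B ≠ C →
      κ.ratio (κ.inv A) (κ.inv B) (κ.inv C) = κ.mul (κ.mul B (κ.ratio A B C)) (κ.inv A) := by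
    intro hD A B C hA hB hC hBC
    obtain ⟨inst, hsum, hprod, h0, h1⟩ := coord hD B C hB hC hBC
    have hadd : ∀ A B, κ.add A B = A + B := fun A B => hsum _ A B
    have hmul : ∀ A B, κ.mul A B = A * B := fun A B => hprod _ A B
    rw [h0] at hA hB hC
    have hBC' : B⁻¹ ≠ C⁻¹ := fun e => hBC (inv_injective e)
    rw [AffinePlane.Auxiliary.inv_eq hmul h1 hA, AffinePlane.Auxiliary.inv_eq hmul h1 hB,
      AffinePlane.Auxiliary.inv_eq hmul h1 hC,
      AffinePlane.Auxiliary.ratio_eq hadd hmul h0 h1 _ hBC',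
      AffinePlane.Auxiliary.ratio_eq hadd hmul h0 h1 _ hBC, hmul, hmul]
    exact AffinePlane.inv_sub_inv_ratio hA hB hC
  refine ⟨fun h A B C hA hB hC _ hBC _ => main h.isCentrallyDesargues A B C hA hB hC hBC,
    fun h A B C hA hB hC hBC => ?_⟩
  rw [main h.isCentrallyDesargues A B C hA hB hC hBC]
  obtain ⟨inst, hsum, hprod, h0, h1⟩ := coord h.isCentrallyDesargues B C hB hC hBC
  have hadd : ∀ A B, κ.add A B = A + B := fun A B => hsum _ A B
  have hmul : ∀ A B, κ.mul A B = A * B := fun A B => hprod _ A B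
  have comm : ∀ X Y : F.Pt, X * Y = Y * X := by
    intro X Y
    by_cases hX : X = 0
    · rw [hX, zero_mul, mul_zero]
    by_cases hY : Y = 0
    · rw [hY, zero_mul, mul_zero]
    -- Both products are computed with the same auxiliary point, as the Pappus argument requires.
    rw [← hprod (κ.forProd X Y), ← hprod (κ.forProd X Y)]
    exact AffinePlane.Frame.prodVia_comm_of_pappus h _ (h0 ▸ hX) (h0 ▸ hY)
  rw [AffinePlane.Auxiliary.ratio_eq hadd hmul h0 h1 _ hA, h0,
    AffinePlane.Auxiliary.ratio_eq hadd hmul h0 h1 _ hBC,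
    AffinePlane.Auxiliary.inv_eq hmul h1 (h0 ▸ hA), hmul, hmul, hmul, sub_zero, sub_zero,
    comm B, mul_assoc _ B, comm B]
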